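/- Let $r,\ell\ge 1$ and let $c=(c_1,\dots,c_r)$ be a profile of rank $r$ and level $\ell$, i.e. a sequence of non-negative integers with $c_1+\dots+c_r=\ell$. A cylindric partition with profile $c$ is an $r$-tuple $\Lambda=(\lambda^{(1)},\dots,\lambda^{(r)})$ of partitions (padded with zeros) with $\lambda^{(i)}_j\ge\lambda^{(i+1)}_{j+c_{i+1}}$ for $1\le i<r$ and $\lambda^{(r)}_j\ge\lambda^{(1)}_{j+c_1}$, for all $j\ge 1$. Its size $|\Lambda|$ is the sum of all its parts. Cylindric partitions with profile $c$ are ordered componentwise. A slice is a cylindric partition with profile $c$ all of whose nonzero parts are $1$; it is identified with its set of boxes (positions of the $1$'s), and its weight is its size. Put $a_i=c_{i+1}+\dots+c_r$; the position $(i,j)$ lies in column $a_i+j$. If a slice has $l_i$ boxes in row $i$, put $R_i=a_i+l_i$; its shape is $(R_1-R_r,\dots,R_{r-1}-R_r)$. This is a partition with at most $r-1$ parts, each at most $\ell$; such partitions are called shapes. The slices of $\Lambda$ are ${}_1\Sigma\ge{}_2\Sigma\ge\dots\ge{}_m\Sigma$, where $m$ is the largest part of $\Lambda$ and ${}_k\Sigma$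 consists of the positions at which the entry of $\Lambda$ is at least $k$. In a finite chain of nonempty slices, the space before a slice $\Sigma$ is the set of boxes of $\Sigma$ that are not in the next smaller slice of the chain (the empty slice if there is none). The space after $\Sigma$ is the set of positions outside $\Sigma$ that are in the next larger slice of the chain (all positions outside $\Sigma$ if there is none). $\Sigma$ is a pivot in the chain if the space after it contains a position whose column is strictly to the left of the column of some box in the space before it. A partition $\beta$ into distinct parts, each labeled by a shape, is called admissible for $c$ if its labeled parts are the weights, labeled by the shapes, of the members of a finite chain of nonempty slices with profile $c$ each of which is a pivot in that chain. For a cylindric partition $\Lambda$ with profile $c$, let $\beta(\Lambda)$ consist of the weights, labeled by the shapes, of the pivots in the chain of distinct slices of $\Lambda$, one copy of each; and let $\mu(\Lambda)$ be the partition formed by the weights of the remaining slices of $\Lambda$, counted with multiplicity. Theorem. The map $\Lambda\mapsto(\mu(\Lambda),\beta(\Lambda))$ is a bijection from the set of cylindric partitions with profile $c$ onto the set of all pairs $(\mu,\beta)$ in which $\mu$ is an unrestricted partition and $\beta$ is a partition into distinct parts labeled by shapes that is admissible for $c$. Moreover $|\Lambda|=|\mu(\Lambda)|+|\beta(\Lambda)|$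 for every $\Lambda$. Whenever $C$ is a finite chain of nonempty slices with profile $c$ each of which is a pivot in $C$, the weights and shapes of its members do form a partition into distinct parts labeled by shapes; and if such a $\beta$ contains the $m$ consecutive integers $n,n+1,\dots,n+m-1$ as parts, then $m\le\min(r-1,\ell-1)$. -/

import Mathlib

/-- A cylindric partition with profile `c = (c_1, …, c_r)` (rows indexed by `Fin r`, columns by `ℕ`,
both from zero).  Each row is a partition, written as a weakly decreasing sequence padded with
zeros.  `finRotate r` is the cyclic successor of the row index, so that `interlace` says
`λ^{(i)}_j ≥ λ^{(i+1)}_{j + c_{i+1}}` for `i < r` and `λ^{(r)}_j ≥ λ^{(1)}_{j + c_1}`. -/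
@[ext]
structure CylindricPartition {r : ℕ} (c : Fin r → ℕ) where
  part : Fin r → ℕ → ℕ
  antitone_part : ∀ i, Antitone (part i)
  eventually_zero : ∀ i, ∃ N, ∀ j, N ≤ j → part i j = 0
  interlace : ∀ i j, part (finRotate r i) (j + c (finRotate r i)) ≤ part i j

namespace CylindricPartition

variable {r : ℕ} {c : Fin r → ℕ}

/-- Componentwise order. -/
instance : PartialOrder (CylindricPartition c) :=
  PartialOrder.lift CylindricPartition.part fun _ _ h => CylindricPartition.ext h

/-- The empty cylindric partition `E`. -/
def empty (c : Fin r → ℕ) : CylindricPartition c where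
  part _ _ := 0
  antitone_part _ _ _ _ := le_rfl
  eventually_zero _ := ⟨0, fun _ _ => rfl⟩
  interlace _ _ := le_rfl

/-- The size (weight) `|Λ|`: the sum of all parts. -/
noncomputable def size (Λ : CylindricPartition c) : ℕ := ∑ i, ∑ᶠ j, Λ.part i j

/-- The largest part of `Λ`; the largest part of each row is its first one. -/
def maxPart (Λ : CylindricPartition c) : ℕ := Finset.univ.sup fun i => Λ.part i 0

/-- A slice is a cylindric partition all of whose (non-zero) parts are equal to `1`. -/
def IsSlice (S : CylindricPartition c) : Prop := ∀ i j, S.part i j ≤ 1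

/-- The `k`-th slice of `Λ` (for `1 ≤ k`): it has a `1` exactly at the positions where the entry of
`Λ` is at least `k`.  -/
def sliceAt (Λ : CylindricPartition c) (k : ℕ) (hk : 1 ≤ k) : CylindricPartition c where
  part i j := if k ≤ Λ.part i j then 1 else 0
  antitone_part i a b hab := by
    have := Λ.antitone_part i hab
    dsimp only
    split_ifs <;> omega
  eventually_zero i := by
    obtain ⟨N, hN⟩ := Λ.eventually_zero i
    refine ⟨N, fun j hj => ?_⟩
    have := hN j hj
    rw [if_neg]
    omega
  interlace i j := by
    have := Λ.interlace i j
    split_ifs <;> omega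

/-- The slices `₁Σ ≥ ₂Σ ≥ ⋯ ≥ ₘΣ` of `Λ` in a list, with multiplicities, where `m` is the largest
part of `Λ`. -/
def sliceList (Λ : CylindricPartition c) : List (CylindricPartition c) :=
  (List.range Λ.maxPart).map fun k => Λ.sliceAt (k + 1) (Nat.succ_pos k)

open Classical in
/-- The chain of distinct slices that occur in `Λ`. -/
noncomputable def sliceChain (Λ : CylindricPartition c) : Finset (CylindricPartition c) :=
  Λ.sliceList.toFinset

/-- The set of positions (row, index in the row) of the non-zero entries, i.e. the boxes of a
slice. -/
def boxes (S : CylindricPartition c) : Set (Fin r × ℕ) := {p | 0 < S.part p.1 p.2}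

end CylindricPartition

/-- The shift to the right of row `i` in the picture of a cylindric partition with profile `c`:
`c_{i+1} + ⋯ + c_r`. -/
def rowShift {r : ℕ} (c : Fin r → ℕ) (i : Fin r) : ℕ := ∑ k ∈ Finset.Ioi i, c k

/-- The column, in the picture, of the position with index `p.2` in row `p.1`. -/
def boxColumn {r : ℕ} (c : Fin r → ℕ) (p : Fin r × ℕ) : ℕ := rowShift c p.1 + p.2

namespace CylindricPartition

variable {r : ℕ} {c : Fin r → ℕ}

/-- The length of row `i` when the Young diagram of the empty cylindric partition is put to the
left of the slice. -/
noncomputable def augmentedLength (S : CylindricPartition c) (i : Fin r) : ℕ :=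
  rowShift c i + {j | 0 < S.part i j}.ncard

/-- The shape of a slice: the augmented row lengths form a partition into `r` parts; subtract the
last of them from the others.  (The augmented lengths of a slice are weakly decreasing, so the
subtraction is never truncated.) -/
noncomputable def shape (S : CylindricPartition c) : Fin (r - 1) → ℕ := fun i =>
  S.augmentedLength ⟨i, i.isLt.trans_le (Nat.sub_le r 1)⟩ -
    S.augmentedLength ⟨r - 1, Nat.sub_one_lt_of_lt (Nat.lt_of_lt_pred i.isLt)⟩

end CylindricPartition

/-- The space before `S` in the chain `C`: the boxes of `S` outside the next smaller member of the
chain (outside nothing, i.e. outside the empty slice, if there is none).  In a chain, being outside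
the next smaller member is the same as being outside all smaller members. -/
def spaceBefore {r : ℕ} {c : Fin r → ℕ} (C : Finset (CylindricPartition c))
    (S : CylindricPartition c) : Set (Fin r × ℕ) :=
  {p | p ∈ S.boxes ∧ ∀ T ∈ C, T < S → p ∉ T.boxes}

/-- The space after `S` in the chain `C`: the positions outside `S` that lie in the next larger
member of the chain, equivalently in all larger members.  If there is none, this is
the infinite strip of all the positions to the right of `S`. -/
def spaceAfter {r : ℕ} {c : Fin r → ℕ} (C : Finset (CylindricPartition c))
    (S : CylindricPartition c) : Set (Fin r × ℕ) :=
  {p | p ∉ S.boxes ∧ ∀ T ∈ C, S < T → p ∈ T.boxes}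

/-- `S` is a pivot in the chain `C`: the space after it has a box strictly to the left of a box in
the space before it. -/
def IsPivot {r : ℕ} {c : Fin r → ℕ} (C : Finset (CylindricPartition c))
    (S : CylindricPartition c) : Prop :=
  ∃ b ∈ spaceAfter C S, ∃ s ∈ spaceBefore C S, boxColumn c b < boxColumn c s

/-- A chain of non-empty slices each of which is a pivot in that chain. -/
def IsPivotChain {r : ℕ} {c : Fin r → ℕ} (C : Finset (CylindricPartition c)) : Prop :=
  IsChain (· ≤ ·) (C : Set (CylindricPartition c)) ∧
    ∀ S ∈ C, S.IsSlice ∧ S ≠ CylindricPartition.empty c ∧ IsPivot C S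

/-- `μ` is an (unrestricted) partition: a multiset of positive integers. -/
def IsUnrestrictedPartition (μ : Multiset ℕ) : Prop := ∀ n ∈ μ, 0 < n

/-- `s` is a shape of rank `r` and level `l`: a partition with at most `r - 1` parts, each at most
`l`, padded with zeros. -/
def IsShape {r : ℕ} (l : ℕ) (s : Fin (r - 1) → ℕ) : Prop := Antitone s ∧ ∀ i, s i ≤ l

/-- `β`, a finite set of pairs (part, label), is a partition into distinct (positive) parts that are
labeled by shapes of rank `r` and level `l`. -/
def IsLabeledDistinctPartition {r : ℕ} (l : ℕ) (β : Finset (ℕ × (Fin (r - 1) → ℕ))) : Prop :=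
  (∀ x ∈ β, 0 < x.1 ∧ IsShape l x.2) ∧ ∀ x ∈ β, ∀ y ∈ β, x.1 = y.1 → x = y

/-- A slice as a labeled part: its weight, labeled by its shape. -/
noncomputable def labeledPart {r : ℕ} {c : Fin r → ℕ} (S : CylindricPartition c) :
    ℕ × (Fin (r - 1) → ℕ) :=
  (S.size, S.shape)

/-- The labeling in `β` is admissible for the profile `c`: the labeled parts of `β` are the weights
and shapes of the members of a chain of slices with profile `c` all of which are pivots. -/
def IsAdmissible {r : ℕ} (c : Fin r → ℕ) (β : Finset (ℕ × (Fin (r - 1) → ℕ))) : Prop :=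
  ∃ C : Finset (CylindricPartition c), IsPivotChain C ∧ C.image labeledPart = β

open Classical in
/-- The partition `β` of `Λ`: one copy of each pivot slice of `Λ`, as labeled parts. -/
noncomputable def pivotPart {r : ℕ} {c : Fin r → ℕ} (Λ : CylindricPartition c) :
    Finset (ℕ × (Fin (r - 1) → ℕ)) :=
  (Λ.sliceChain.filter (IsPivot Λ.sliceChain)).image labeledPart

/-- The partition `μ` of `Λ`: the weights of the slices of `Λ` that remain after one copy of
each pivot slice has been taken out. -/
noncomputable def remainingPart {r : ℕ} {c : Fin r → ℕ} (Λ : CylindricPartition c) :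
    Multiset ℕ :=
  ((Λ.sliceList.map CylindricPartition.size : List ℕ) : Multiset ℕ) -
    (pivotPart Λ).val.map Prod.fst

/-- The `m` consecutive integers `n, n + 1, …, n + m - 1` are parts of `β`. -/
def HasRun {r : ℕ} (β : Finset (ℕ × (Fin (r - 1) → ℕ))) (n m : ℕ) : Prop :=
  ∀ k < m, ∃ x ∈ β, x.1 = n + k

/-! Order the positions by column, breaking ties by row (`boxKey`). If p lies outside a slice and q
inside it, a tie of columns never puts p first, so a member of a chain is a non-pivot exactly when
every key in the space before it is smaller than every key in the space after it. A finite chain D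
of slices thus suggests a total order on positions, `boxRank D`: first by how many members of D miss
the position, then by key. Since the level is positive, this order respects the cylindric
inequalities, so its finite initial segments are slices, exactly one of each weight.

Two facts give the bijection. If D is the set of pivots of Λ, every slice of Λ is an initial segment
for D (`isInitialFor_filter_isPivot`), hence is recovered from D and its weight; and D is recovered
from its labels, because weight and shape determine a slice. Conversely, adding initial segments to
a pivot chain D neither creates nor destroys pivots (`filter_isPivot_eq`), so μ can be arbitrary.
Stacking turns the resulting multiset of slices back into a cylindric partition (`sliceList_stack`).

For the bound on runs, pivots of consecutive weights differ by one box. These boxes move strictly to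
the left while lying in distinct rows other than the first, and the columns available span less than
the level. -/

namespace CylindricPartition

variable {r : ℕ} {c : Fin r → ℕ}

/-! ### Row lengths of a slice -/

/-- The number of nonzero entries of a row. -/
noncomputable def rowLength (S : CylindricPartition c) (i : Fin r) : ℕ :=
  {j | 0 < S.part i j}.ncard

theorem part_pos_iff (S : CylindricPartition c) (i : Fin r) (j : ℕ) :
    0 < S.part i j ↔ j < S.rowLength i := by
  classical
  have h0 : ∃ N, S.part i N = 0 := by
    obtain ⟨N, hN⟩ := S.eventually_zero i
    exact ⟨N, hN N le_rfl⟩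
  have key : ∀ k, 0 < S.part i k ↔ k < Nat.find h0 := by
    intro k
    constructor
    · intro hk
      by_contra hlt
      have := S.antitone_part i (not_lt.mp hlt)
      rw [Nat.find_spec h0] at this
      omega
    · intro hk
      exact Nat.pos_of_ne_zero (Nat.find_min h0 hk)
  have hset : {k | 0 < S.part i k} = ↑(Finset.range (Nat.find h0)) := by
    ext k
    simpa using key k
  rw [key, rowLength, hset, Set.ncard_coe_finset, Finset.card_range]

theorem rowLength_interlace (S : CylindricPartition c) (i : Fin r) :
    S.rowLength (finRotate r i) ≤ S.rowLength i + c (finRotate r i) := by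
  by_contra h
  push Not at h
  have h1 := (S.part_pos_iff _ _).mpr h
  have h2 := (S.part_pos_iff _ _).mp (h1.trans_le (S.interlace i (S.rowLength i)))
  exact lt_irrefl _ h2

theorem augmentedLength_eq (S : CylindricPartition c) (i : Fin r) :
    S.augmentedLength i = rowShift c i + S.rowLength i := rfl

theorem mem_boxes_iff (S : CylindricPartition c) (p : Fin r × ℕ) :
    p ∈ S.boxes ↔ boxColumn c p < S.augmentedLength p.1 := by
  have h := S.part_pos_iff p.1 p.2
  rw [boxColumn, augmentedLength_eq, add_lt_add_iff_left, ← h]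
  rfl

end CylindricPartition

/-! ### Columns and the key order on positions -/

theorem rowShift_castSucc {n : ℕ} (c : Fin (n + 1) → ℕ) (i : Fin n) :
    rowShift c i.castSucc = c i.succ + rowShift c i.succ := by
  have : Finset.Ioi i.castSucc = insert i.succ (Finset.Ioi i.succ) := by
    ext k
    simp only [Finset.mem_Ioi, Finset.mem_insert, Fin.lt_def, Fin.ext_iff, Fin.val_succ,
      Fin.val_castSucc]
    omega
  rw [rowShift, this, Finset.sum_insert (by simp)]
  rfl

theorem rowShift_last {n : ℕ} (c : Fin (n + 1) → ℕ) : rowShift c (Fin.last n) = 0 := by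
  have : Finset.Ioi (Fin.last n) = ∅ := by
    ext k
    simp [Fin.le_last]
  rw [rowShift, this, Finset.sum_empty]

theorem rowShift_zero {n : ℕ} (c : Fin (n + 1) → ℕ) : c 0 + rowShift c 0 = ∑ i, c i := by
  rw [Fin.sum_univ_succ, rowShift]
  congr 1
  have : Finset.Ioi (0 : Fin (n + 1)) = Finset.univ.map (Fin.succEmb n) := by
    ext k
    simp only [Finset.mem_Ioi, Finset.mem_map, Finset.mem_univ, true_and, Fin.coe_succEmb]
    rw [Fin.exists_succ_eq, Fin.pos_iff_ne_zero]
  rw [this, Finset.sum_map]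
  rfl

/-- The column of a position, refined to a total order by the row. -/
def boxKey {r : ℕ} (c : Fin r → ℕ) (p : Fin r × ℕ) : ℕ := boxColumn c p * r + p.1

theorem boxKey_lt_iff {r : ℕ} (c : Fin r → ℕ) (p q : Fin r × ℕ) :
    boxKey c p < boxKey c q ↔
      boxColumn c p < boxColumn c q ∨ boxColumn c p = boxColumn c q ∧ p.1 < q.1 := by
  have hp := p.1.isLt
  have hq := q.1.isLt
  unfold boxKey
  rcases lt_trichotomy (boxColumn c p) (boxColumn c q) with h | h | h
  · have := Nat.mul_le_mul_right r (Nat.succ_le_of_lt h)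
    rw [Nat.succ_mul] at this
    simp only [h, true_or, iff_true]
    omega
  · simp [h]
  · have := Nat.mul_le_mul_right r (Nat.succ_le_of_lt h)
    rw [Nat.succ_mul] at this
    simp only [h.not_gt, h.ne', false_or, false_and, iff_false]
    omega

theorem boxKey_injective {r : ℕ} (c : Fin r → ℕ) : Function.Injective (boxKey c) := by
  intro p q h
  have h1 := (boxKey_lt_iff c p q).not.mp h.not_lt
  have h2 := (boxKey_lt_iff c q p).not.mp h.not_gt
  have h3 : boxColumn c p = boxColumn c q := by omega
  have h4 : p.1 = q.1 := by
    refine le_antisymm ?_ ?_ <;> by_contra h5 <;> simp_all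
  refine Prod.ext h4 ?_
  simp only [boxColumn, h4] at h3
  omega

theorem boxColumn_finRotate {r : ℕ} (c : Fin r → ℕ) (i : Fin r) (j : ℕ) :
    (boxColumn c (finRotate r i, j + c (finRotate r i)) = boxColumn c (i, j) ∧
      i < finRotate r i) ∨
    boxColumn c (finRotate r i, j + c (finRotate r i)) = boxColumn c (i, j) + ∑ k, c k := by
  obtain ⟨n, rfl⟩ : ∃ n, r = n + 1 := ⟨r - 1, by have := i.isLt; omega⟩
  induction i using Fin.lastCases with
  | last =>
    right
    rw [finRotate_last, ← rowShift_zero c]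
    simp only [boxColumn, rowShift_last]
    omega
  | cast i =>
    left
    have : finRotate (n + 1) i.castSucc = i.succ := by simp
    rw [this]
    simp only [boxColumn, rowShift_castSucc]
    exact ⟨by omega, by simp⟩

/-- Between successive rows the column is unchanged and the row grows. From the last row back to the
first the row does not grow, and only the jump of the column by the positive level keeps the key
increasing. -/
theorem boxKey_finRotate_le {r : ℕ} (c : Fin r → ℕ) (hc : 0 < ∑ k, c k) (i : Fin r) (j : ℕ) :
    boxKey c (i, j) ≤ boxKey c (finRotate r i, j + c (finRotate r i)) := by
  apply le_of_lt
  rw [boxKey_lt_iff]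
  rcases boxColumn_finRotate c i j with h | h
  · exact Or.inr ⟨h.1.symm, h.2⟩
  · left
    omega

theorem boxKey_le_of_le {r : ℕ} (c : Fin r → ℕ) (i : Fin r) {a b : ℕ} (h : a ≤ b) :
    boxKey c (i, a) ≤ boxKey c (i, b) := by
  unfold boxKey boxColumn
  gcongr

/-! ### Geometry of slices: boxes, weights and shapes -/

namespace CylindricPartition

variable {r : ℕ} {c : Fin r → ℕ}

theorem augmentedLength_antitone (S : CylindricPartition c) : Antitone S.augmentedLength := by
  rcases Nat.eq_zero_or_pos r with rfl | hr
  · intro i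
    exact i.elim0
  obtain ⟨n, rfl⟩ : ∃ n, r = n + 1 := ⟨r - 1, by omega⟩
  rw [Fin.antitone_iff_succ_le]
  intro i
  have h := S.rowLength_interlace i.castSucc
  have hrot : finRotate (n + 1) i.castSucc = i.succ := by simp
  rw [hrot] at h
  have h2 := rowShift_castSucc c i
  simp only [augmentedLength_eq]
  omega

theorem augmentedLength_le_add (S : CylindricPartition c) (i k : Fin r) :
    S.augmentedLength i ≤ S.augmentedLength k + ∑ k, c k := by
  obtain ⟨n, rfl⟩ : ∃ n, r = n + 1 := ⟨r - 1, by have := i.isLt; omega⟩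
  have h1 := S.augmentedLength_antitone (Fin.zero_le i)
  have h2 := S.augmentedLength_antitone (Fin.le_last k)
  have h := S.rowLength_interlace (Fin.last n)
  rw [finRotate_last] at h
  have h3 := rowShift_last c
  have h4 := rowShift_zero c
  simp only [augmentedLength_eq] at *
  omega

theorem mem_boxes_of_le (S : CylindricPartition c) {p q : Fin r × ℕ} (hq : q ∈ S.boxes)
    (hrow : p.1 ≤ q.1) (hcol : boxColumn c p ≤ boxColumn c q) : p ∈ S.boxes := by
  rw [mem_boxes_iff] at *
  exact (hcol.trans_lt hq).trans_le (S.augmentedLength_antitone hrow)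

theorem boxColumn_lt_add (S : CylindricPartition c) {p q : Fin r × ℕ} (hq : q ∈ S.boxes)
    (hp : p ∉ S.boxes) : boxColumn c q < boxColumn c p + ∑ k, c k := by
  rw [mem_boxes_iff] at *
  have := S.augmentedLength_le_add q.1 p.1
  omega

/-- Lets pivots be tested with the total order of keys: a tie of columns with p in the higher row
would force p into the slice. -/
theorem boxKey_lt_iff_boxColumn_lt (S : CylindricPartition c) {p q : Fin r × ℕ}
    (hq : q ∈ S.boxes) (hp : p ∉ S.boxes) :
    boxKey c p < boxKey c q ↔ boxColumn c p < boxColumn c q := by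
  rw [boxKey_lt_iff]
  refine ⟨fun h => h.resolve_right fun h' => hp ?_, Or.inl⟩
  exact S.mem_boxes_of_le hq h'.2.le h'.1.le

theorem IsSlice.le_iff {S T : CylindricPartition c} (hS : S.IsSlice) :
    S ≤ T ↔ S.boxes ⊆ T.boxes := by
  refine ⟨fun h p hp => lt_of_lt_of_le hp (h p.1 p.2), fun h i j => ?_⟩
  have h1 : 0 < S.part i j → 0 < T.part i j := fun h' => h (a := (i, j)) h'
  have := hS i j
  change S.part i j ≤ T.part i j
  omega

theorem boxes_subset_of_le {S T : CylindricPartition c} (h : S ≤ T) : S.boxes ⊆ T.boxes :=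
  fun p hp => lt_of_lt_of_le hp (h p.1 p.2)

theorem IsSlice.eq_of_boxes_eq {S T : CylindricPartition c} (hS : S.IsSlice) (hT : T.IsSlice)
    (h : S.boxes = T.boxes) : S = T :=
  le_antisymm (hS.le_iff.mpr h.subset) (hT.le_iff.mpr h.symm.subset)

theorem exists_boxes_eq_coe (S : CylindricPartition c) :
    ∃ s : Finset (Fin r × ℕ), S.boxes = s ∧ s.card = ∑ i, S.rowLength i := by
  refine ⟨(Finset.univ.sigma fun i => Finset.range (S.rowLength i)).map
    (Equiv.sigmaEquivProd (Fin r) ℕ).toEmbedding, ?_, ?_⟩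
  · ext p
    simp only [boxes, part_pos_iff, Set.mem_ofPred_eq, Finset.coe_map, Set.mem_image]
    exact ⟨fun h => ⟨⟨p.1, p.2⟩, by simpa using h, rfl⟩, by rintro ⟨x, hx, rfl⟩; simpa using hx⟩
  · simp

theorem boxes_finite (S : CylindricPartition c) : S.boxes.Finite := by
  obtain ⟨s, hs, -⟩ := S.exists_boxes_eq_coe
  exact hs ▸ s.finite_toSet

theorem IsSlice.size_eq_sum {S : CylindricPartition c} (hS : S.IsSlice) :
    S.size = ∑ i, S.rowLength i := by
  refine Finset.sum_congr rfl fun i _ => ?_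
  have h : S.part i = fun j => if j ∈ Finset.range (S.rowLength i) then 1 else 0 := by
    ext j
    have h1 := S.part_pos_iff i j
    have h2 := hS i j
    simp only [Finset.mem_range]
    split_ifs <;> omega
  rw [h, finsum_eq_sum_of_support_subset (s := Finset.range (S.rowLength i))]
  · rw [Finset.sum_ite_mem, Finset.inter_self, Finset.sum_const, Finset.card_range, smul_eq_mul,
      mul_one]
  · intro j hj
    by_contra h'
    exact hj (if_neg h')

theorem IsSlice.size_eq_ncard {S : CylindricPartition c} (hS : S.IsSlice) :
    S.size = S.boxes.ncard := by
  obtain ⟨s, hs, hcard⟩ := S.exists_boxes_eq_coe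
  rw [hS.size_eq_sum, hs, Set.ncard_coe_finset, hcard]

theorem IsSlice.eq_of_le_of_size_le {S T : CylindricPartition c} (hS : S.IsSlice)
    (hT : T.IsSlice) (h : S ≤ T) (hsize : T.size ≤ S.size) : S = T := by
  rw [hS.size_eq_ncard, hT.size_eq_ncard] at hsize
  exact hS.eq_of_boxes_eq hT (Set.eq_of_subset_of_ncard_le (boxes_subset_of_le h) hsize
    T.boxes_finite)

theorem IsSlice.boxes_nonempty {S : CylindricPartition c} (hS : S.IsSlice) (h : S ≠ empty c) :
    S.boxes.Nonempty := by
  by_contra h'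
  rw [Set.not_nonempty_iff_eq_empty] at h'
  refine h (hS.eq_of_boxes_eq (fun _ _ => Nat.zero_le _) ?_)
  rw [h']
  ext p
  simp [boxes, empty]

theorem IsSlice.size_pos {S : CylindricPartition c} (hS : S.IsSlice) (h : S ≠ empty c) :
    0 < S.size := by
  rw [hS.size_eq_ncard, Set.ncard_pos S.boxes_finite]
  exact hS.boxes_nonempty h

theorem isShape_shape (S : CylindricPartition c) : IsShape (∑ k, c k) S.shape := by
  refine ⟨fun i k hik => Nat.sub_le_sub_right (S.augmentedLength_antitone ?_) _, fun i => ?_⟩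
  · exact hik
  · have := S.augmentedLength_le_add ⟨i, i.isLt.trans_le (Nat.sub_le r 1)⟩
      ⟨r - 1, Nat.sub_one_lt_of_lt (Nat.lt_of_lt_pred i.isLt)⟩
    unfold shape
    omega

/-- The shape fixes the augmented lengths up to a common translation, and the weight fixes the
translation. -/
theorem IsSlice.eq_of_labeledPart_eq {S T : CylindricPartition c} (hS : S.IsSlice)
    (hT : T.IsSlice) (h : labeledPart S = labeledPart T) : S = T := by
  rcases Nat.eq_zero_or_pos r with rfl | hr
  · ext i
    exact i.elim0
  obtain ⟨n, rfl⟩ : ∃ n, r = n + 1 := ⟨r - 1, by omega⟩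
  obtain ⟨hsize, hshape⟩ := Prod.ext_iff.mp h
  have hsize : S.size = T.size := hsize
  rw [hS.size_eq_sum, hT.size_eq_sum] at hsize
  have haug : ∑ i, S.augmentedLength i = ∑ i, T.augmentedLength i := by
    simp only [augmentedLength_eq, Finset.sum_add_distrib, hsize]
  have hdiff : ∀ i, S.augmentedLength i + T.augmentedLength (Fin.last n) =
      T.augmentedLength i + S.augmentedLength (Fin.last n) := by
    intro i
    induction i using Fin.lastCases with
    | last => omega
    | cast i =>
      have h1 : S.augmentedLength i.castSucc - S.augmentedLength (Fin.last n) =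
        T.augmentedLength i.castSucc - T.augmentedLength (Fin.last n) := congrFun hshape i
      -- Monotonicity ensures that the natural subtractions in the shapes are not truncated.
      have h2 := S.augmentedLength_antitone (Fin.le_last i.castSucc)
      have h3 := T.augmentedLength_antitone (Fin.le_last i.castSucc)
      omega
  have hsum := Finset.sum_congr (rfl : (Finset.univ : Finset (Fin (n + 1))) = Finset.univ)
    fun i _ => hdiff i
  rw [Finset.sum_add_distrib, Finset.sum_add_distrib, haug] at hsum
  simp only [Finset.sum_const, Finset.card_univ, Fintype.card_fin, smul_eq_mul,
    add_right_inj] at hsum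
  have hlast := Nat.eq_of_mul_eq_mul_left (Nat.succ_pos n) hsum
  refine hS.eq_of_boxes_eq hT ?_
  ext p
  have := hdiff p.1
  rw [mem_boxes_iff, mem_boxes_iff]
  omega

end CylindricPartition

/-! ### The order on positions attached to a chain -/

open Classical in
/-- The number of members of `C` that do not contain the position `p`. -/
noncomputable def boxLevel {r : ℕ} {c : Fin r → ℕ} (C : Finset (CylindricPartition c))
    (p : Fin r × ℕ) : ℕ :=
  (C.filter fun S => p ∉ S.boxes).card

/-- The order in which the positions are added when the chain `C` is refined to a maximal chain,
the boxes between consecutive members of `C` being added in increasing order of their keys. -/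
noncomputable def boxRank {r : ℕ} {c : Fin r → ℕ} (C : Finset (CylindricPartition c))
    (p : Fin r × ℕ) : ℕ ×ₗ ℕ :=
  toLex (boxLevel C p, boxKey c p)

/-- The positions in `B` form an initial segment of the order `boxRank C`. -/
def IsInitialFor {r : ℕ} {c : Fin r → ℕ} (C : Finset (CylindricPartition c))
    (B : Set (Fin r × ℕ)) : Prop :=
  ∀ p ∈ B, ∀ q ∉ B, boxRank C p < boxRank C q

section

variable {r : ℕ} {c : Fin r → ℕ} {C D : Finset (CylindricPartition c)}

theorem boxRank_lt_iff {p q : Fin r × ℕ} : boxRank C p < boxRank C q ↔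
    boxLevel C p < boxLevel C q ∨ boxLevel C p = boxLevel C q ∧ boxKey c p < boxKey c q :=
  Prod.Lex.toLex_lt_toLex

theorem boxRank_injective (C : Finset (CylindricPartition c)) :
    Function.Injective (boxRank C) := fun _ _ h =>
  boxKey_injective c (congrArg (fun x => (ofLex x).2) h)

theorem boxLevel_le_of_forall {p q : Fin r × ℕ} (h : ∀ S ∈ C, q ∈ S.boxes → p ∈ S.boxes) :
    boxLevel C p ≤ boxLevel C q := by
  classical
  refine Finset.card_le_card fun S hS => ?_
  rw [Finset.mem_filter] at *
  exact ⟨hS.1, fun h' => hS.2 (h S hS.1 h')⟩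

theorem boxLevel_lt_of_forall {p q : Fin r × ℕ} (h : ∀ S ∈ C, q ∈ S.boxes → p ∈ S.boxes)
    {S : CylindricPartition c} (hS : S ∈ C) (hp : p ∈ S.boxes) (hq : q ∉ S.boxes) :
    boxLevel C p < boxLevel C q := by
  classical
  refine Finset.card_lt_card ⟨fun T hT => ?_, fun h' => ?_⟩
  · rw [Finset.mem_filter] at *
    exact ⟨hT.1, fun h' => hT.2 (h T hT.1 h')⟩
  · exact (Finset.mem_filter.mp (h' (Finset.mem_filter.mpr ⟨hS, hq⟩))).2 hp

theorem exists_mem_of_boxLevel_lt {p q : Fin r × ℕ} (h : boxLevel C p < boxLevel C q) :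
    ∃ S ∈ C, p ∈ S.boxes ∧ q ∉ S.boxes := by
  by_contra! h'
  exact h.not_ge (boxLevel_le_of_forall fun S hS hp => h' S hS hp)

theorem IsInitialFor.subset_or_subset {A B : Set (Fin r × ℕ)} (hA : IsInitialFor C A)
    (hB : IsInitialFor C B) : A ⊆ B ∨ B ⊆ A := by
  by_contra! h
  obtain ⟨⟨p, hpA, hpB⟩, q, hqB, hqA⟩ := And.imp Set.not_subset.mp Set.not_subset.mp h
  exact lt_asymm (hA p hpA q hqA) (hB q hqB p hpB)

theorem forall_mem_boxes_of_isChain (hC : IsChain (· ≤ ·) (C : Set (CylindricPartition c)))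
    {S : CylindricPartition c} (hS : S ∈ C) {p q : Fin r × ℕ} (hp : p ∈ S.boxes)
    (hq : q ∉ S.boxes) : ∀ T ∈ C, q ∈ T.boxes → p ∈ T.boxes := by
  intro T hT hqT
  rcases hC.total hS hT with h | h
  · exact CylindricPartition.boxes_subset_of_le h hp
  · exact absurd (CylindricPartition.boxes_subset_of_le h hqT) hq

theorem IsChain.isInitialFor (hC : IsChain (· ≤ ·) (C : Set (CylindricPartition c)))
    {S : CylindricPartition c} (hS : S ∈ C) : IsInitialFor C S.boxes := fun _ hp _ hq =>
  boxRank_lt_iff.mpr <| Or.inl <|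
    boxLevel_lt_of_forall (forall_mem_boxes_of_isChain hC hS hp hq) hS hp hq

theorem boxKey_lt_of_not_isPivot {S : CylindricPartition c} (hpiv : ¬ IsPivot C S)
    {p q : Fin r × ℕ} (hp : p ∈ spaceBefore C S) (hq : q ∈ spaceAfter C S) :
    boxKey c p < boxKey c q := by
  by_contra h
  refine hpiv ⟨q, hq, p, hp, (S.boxKey_lt_iff_boxColumn_lt hp.1 hq.1).mp ?_⟩
  refine lt_of_le_of_ne (not_lt.mp h) fun h' => ?_
  exact hq.1 (boxKey_injective c h' ▸ hp.1)

/-- If no member of the chain that separates `p` from `q` is a pivot, then the keys of `p` and `q`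
are in increasing order. -/
theorem boxKey_lt_of_forall_not_isPivot
    (hC : IsChain (· ≤ ·) (C : Set (CylindricPartition c))) (hslice : ∀ S ∈ C, S.IsSlice)
    {p q : Fin r × ℕ} (hlt : boxLevel C p < boxLevel C q)
    (h : ∀ S ∈ C, p ∈ S.boxes → q ∉ S.boxes → ¬ IsPivot C S) : boxKey c p < boxKey c q := by
  classical
  induction hn : boxLevel C q - boxLevel C p using Nat.strong_induction_on generalizing p with
  | _ n ih =>
  have hne : (C.filter fun S => p ∈ S.boxes ∧ q ∉ S.boxes).Nonempty := by
    obtain ⟨S, hS, h1, h2⟩ := exists_mem_of_boxLevel_lt hlt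
    exact ⟨S, Finset.mem_filter.mpr ⟨hS, h1, h2⟩⟩
  -- A smaller member containing p would also separate p from q, so minimality puts p in the space
  -- before S.
  obtain ⟨S, hSmin⟩ := Finset.exists_minimal hne
  obtain ⟨hS, hpS, hqS⟩ := Finset.mem_filter.mp hSmin.prop
  have hp : p ∈ spaceBefore C S := ⟨hpS, fun T hT hTS hpT => hSmin.not_lt (Finset.mem_filter.mpr
    ⟨hT, hpT, fun hqT => hqS (CylindricPartition.boxes_subset_of_le hTS.le hqT)⟩) hTS⟩
  have hpiv := h S hS hpS hqS
  by_cases hq : q ∈ spaceAfter C S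
  · exact boxKey_lt_of_not_isPivot hpiv hp hq
  obtain ⟨T₀, hT₀, hST₀, hqT₀⟩ : ∃ T ∈ C, S < T ∧ q ∉ T.boxes := by
    by_contra! h'
    exact hq ⟨hqS, h'⟩
  have hne' : (C.filter fun T => S < T).Nonempty := ⟨T₀, Finset.mem_filter.mpr ⟨hT₀, hST₀⟩⟩
  obtain ⟨T, hTmin⟩ := Finset.exists_minimal hne'
  obtain ⟨hT, hST⟩ := Finset.mem_filter.mp hTmin.prop
  have hTle : ∀ U ∈ C, S < U → T ≤ U := fun U hU hSU =>
    (hC.total hT hU).elim id (hTmin.le_of_le (Finset.mem_filter.mpr ⟨hU, hSU⟩))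
  have hqT : q ∉ T.boxes := fun h' =>
    hqT₀ (CylindricPartition.boxes_subset_of_le (hTle T₀ hT₀ hST₀) h')
  -- Here T is the successor of S in the chain and still misses q. Any b in T outside S serves as an
  -- intermediate position: S handles p and b, and induction handles b and q.
  obtain ⟨b, hbT, hbS⟩ := Set.not_subset.mp fun h' => hST.not_ge ((hslice T hT).le_iff.mpr h')
  have hb : b ∈ spaceAfter C S :=
    ⟨hbS, fun U hU hSU => CylindricPartition.boxes_subset_of_le (hTle U hU hSU) hbT⟩
  have hlt₁ : boxLevel C p < boxLevel C b :=
    boxLevel_lt_of_forall (forall_mem_boxes_of_isChain hC hS hpS hbS) hS hpS hbS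
  have hlt₂ : boxLevel C b < boxLevel C q :=
    boxLevel_lt_of_forall (forall_mem_boxes_of_isChain hC hT hbT hqT) hT hbT hqT
  refine (boxKey_lt_of_not_isPivot hpiv hp hb).trans (ih _ ?_ hlt₂ (fun U hU hbU hqU => ?_) rfl)
  · omega
  · exact h U hU (forall_mem_boxes_of_isChain hC hS hpS hbS U hU hbU) hqU

open Classical in
-- Positions separated by a pivot are ordered by level; if no pivot separates them, all separating
-- members are non-pivots and the keys are already increasing.
theorem isInitialFor_filter_isPivot
    (hC : IsChain (· ≤ ·) (C : Set (CylindricPartition c))) (hslice : ∀ S ∈ C, S.IsSlice)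
    {S : CylindricPartition c} (hS : S ∈ C) : IsInitialFor (C.filter (IsPivot C)) S.boxes := by
  intro p hp q hq
  have hsep := forall_mem_boxes_of_isChain hC hS hp hq
  have hle : boxLevel (C.filter (IsPivot C)) p ≤ boxLevel (C.filter (IsPivot C)) q :=
    boxLevel_le_of_forall fun T hT => hsep T (Finset.mem_of_mem_filter T hT)
  rw [boxRank_lt_iff]
  refine hle.lt_or_eq.imp_right fun heq => ⟨heq, ?_⟩
  refine boxKey_lt_of_forall_not_isPivot hC hslice (boxLevel_lt_of_forall hsep hS hp hq) ?_
  intro T hT hpT hqT hpiv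
  exact heq.not_lt (boxLevel_lt_of_forall (fun U hU => hsep U (Finset.mem_of_mem_filter U hU))
    (Finset.mem_filter.mpr ⟨hT, hpiv⟩) hpT hqT)

open Classical in
theorem isPivotChain_filter_isPivot
    (hC : IsChain (· ≤ ·) (C : Set (CylindricPartition c)))
    (hslice : ∀ S ∈ C, S.IsSlice ∧ S ≠ CylindricPartition.empty c) :
    IsPivotChain (C.filter (IsPivot C)) := by
  refine ⟨hC.mono fun S hS => Finset.mem_of_mem_filter S hS, fun S hS => ?_⟩
  obtain ⟨hSC, b, hb, s, hs, hlt⟩ := Finset.mem_filter.mp hS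
  exact ⟨(hslice S hSC).1, (hslice S hSC).2, b,
    ⟨hb.1, fun T hT => hb.2 T (Finset.mem_of_mem_filter T hT)⟩, s,
    ⟨hs.1, fun T hT => hs.2 T (Finset.mem_of_mem_filter T hT)⟩, hlt⟩

/-! ### Initial segments as slices -/

theorem exists_finset_isInitialFor (hr : 0 < r) (D : Finset (CylindricPartition c)) (n : ℕ) :
    ∃ U : Finset (Fin r × ℕ), U.card = n ∧ IsInitialFor D U := by
  classical
  induction n with
  | zero => exact ⟨∅, rfl, fun p hp => absurd hp (by simp)⟩
  | succ n ih =>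
    obtain ⟨U, hcard, hU⟩ := ih
    have : Nonempty (Fin r) := ⟨⟨0, hr⟩⟩
    obtain ⟨b₀, hb₀⟩ := Infinite.exists_notMem_finset U
    -- The next box is the position of least rank not yet used.
    obtain ⟨b, hb, hmin⟩ := (InvImage.wf (boxRank D) wellFounded_lt).has_min
      {b | b ∉ U} ⟨b₀, hb₀⟩
    refine ⟨insert b U, by rw [Finset.card_insert_of_notMem hb, hcard], fun p hp q hq => ?_⟩
    rw [Finset.mem_coe, Finset.mem_insert] at hp hq
    push Not at hq
    rcases hp with rfl | hp
    · exact lt_of_le_of_ne (not_lt.mp (hmin q hq.2)) fun h => hq.1 (boxRank_injective D h).symm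
    · exact hU p hp q hq.2

/-- Levels are monotone because members of D satisfy the interlacing condition, and keys are
monotone by themselves. With `boxRank_le_of_le` this makes initial segments cylindric. -/
theorem boxRank_finRotate_le (hc : 0 < ∑ k, c k) (D : Finset (CylindricPartition c))
    (i : Fin r) (j : ℕ) :
    boxRank D (i, j) ≤ boxRank D (finRotate r i, j + c (finRotate r i)) :=
  Prod.Lex.toLex_mono ⟨boxLevel_le_of_forall fun S _ h =>
    (show 0 < _ from h).trans_le (S.interlace i j), boxKey_finRotate_le c hc i j⟩

theorem boxRank_le_of_le (D : Finset (CylindricPartition c)) (i : Fin r) {a b : ℕ}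
    (h : a ≤ b) : boxRank D (i, a) ≤ boxRank D (i, b) :=
  Prod.Lex.toLex_mono ⟨boxLevel_le_of_forall fun S _ hS =>
    (show 0 < _ from hS).trans_le (S.antitone_part i h), boxKey_le_of_le c i h⟩

open Classical in
/-- The slice whose boxes are a given finite initial segment of the order `boxRank D`. -/
noncomputable def sliceOfInitial (hc : 0 < ∑ k, c k) (D : Finset (CylindricPartition c))
    (U : Finset (Fin r × ℕ)) (hU : IsInitialFor D U) : CylindricPartition c where
  part i j := if (i, j) ∈ U then 1 else 0
  antitone_part i a b hab := by
    have : (i, b) ∈ U → (i, a) ∈ U := fun hb => by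
      by_contra ha
      exact (hU _ hb _ ha).not_ge (boxRank_le_of_le D i hab)
    dsimp only
    split_ifs <;> simp_all
  eventually_zero i := by
    refine ⟨U.sup Prod.snd + 1, fun j hj => if_neg fun h => ?_⟩
    have : j ≤ U.sup Prod.snd := Finset.le_sup (f := Prod.snd) h
    omega
  interlace i j := by
    have : (finRotate r i, j + c (finRotate r i)) ∈ U → (i, j) ∈ U := fun hb => by
      by_contra ha
      exact (hU _ hb _ ha).not_ge (boxRank_finRotate_le hc D i j)
    split_ifs <;> simp_all

theorem exists_isSlice_isInitialFor (hr : 0 < r) (hc : 0 < ∑ k, c k)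
    (D : Finset (CylindricPartition c)) (n : ℕ) :
    ∃ S : CylindricPartition c, S.IsSlice ∧ IsInitialFor D S.boxes ∧ S.size = n := by
  classical
  obtain ⟨U, hcard, hU⟩ := exists_finset_isInitialFor hr D n
  have hslice : (sliceOfInitial hc D U hU).IsSlice := fun i j => by
    unfold sliceOfInitial
    dsimp only
    split_ifs <;> omega
  have hboxes : (sliceOfInitial hc D U hU).boxes = U := by
    ext p
    by_cases h : p ∈ U <;> simp [CylindricPartition.boxes, sliceOfInitial, h]
  refine ⟨_, hslice, hboxes.symm ▸ hU, ?_⟩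
  rw [hslice.size_eq_ncard, hboxes, Set.ncard_coe_finset, hcard]

theorem CylindricPartition.IsSlice.eq_of_isInitialFor {S T : CylindricPartition c}
    (hS : S.IsSlice) (hT : T.IsSlice) (hSD : IsInitialFor D S.boxes)
    (hTD : IsInitialFor D T.boxes) (h : S.size = T.size) : S = T := by
  rcases hSD.subset_or_subset hTD with h' | h'
  · exact hS.eq_of_le_of_size_le hT (hS.le_iff.mpr h') h.ge
  · exact (hT.eq_of_le_of_size_le hS (hT.le_iff.mpr h') h.le).symm

/-- The slice of weight `n` in the maximal chain obtained by refining `D`. -/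
noncomputable def refinedSlice (hr : 0 < r) (hc : 0 < ∑ k, c k)
    (D : Finset (CylindricPartition c)) (n : ℕ) : CylindricPartition c :=
  (exists_isSlice_isInitialFor hr hc D n).choose

theorem isSlice_refinedSlice (hr : 0 < r) (hc : 0 < ∑ k, c k)
    (D : Finset (CylindricPartition c)) (n : ℕ) : (refinedSlice hr hc D n).IsSlice :=
  (exists_isSlice_isInitialFor hr hc D n).choose_spec.1

theorem isInitialFor_refinedSlice (hr : 0 < r) (hc : 0 < ∑ k, c k)
    (D : Finset (CylindricPartition c)) (n : ℕ) :
    IsInitialFor D (refinedSlice hr hc D n).boxes :=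
  (exists_isSlice_isInitialFor hr hc D n).choose_spec.2.1

theorem size_refinedSlice (hr : 0 < r) (hc : 0 < ∑ k, c k)
    (D : Finset (CylindricPartition c)) (n : ℕ) : (refinedSlice hr hc D n).size = n :=
  (exists_isSlice_isInitialFor hr hc D n).choose_spec.2.2

theorem refinedSlice_size (hr : 0 < r) (hc : 0 < ∑ k, c k) {S : CylindricPartition c}
    (hS : S.IsSlice) (hSD : IsInitialFor D S.boxes) : refinedSlice hr hc D S.size = S :=
  (isSlice_refinedSlice hr hc D _).eq_of_isInitialFor hS (isInitialFor_refinedSlice hr hc D _) hSD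
    (size_refinedSlice hr hc D _)

/-! ### Refinement preserves the set of pivots -/

/-- Members of a chain between the pivots of `D` that refine `D` in increasing order of the keys
are not pivots. -/
theorem not_isPivot_of_isInitialFor (hDC : D ⊆ C)
    (hC : IsChain (· ≤ ·) (C : Set (CylindricPartition c))) {S : CylindricPartition c}
    (hS : S ∈ C) (hSD : S ∉ D) (hinit : IsInitialFor D S.boxes) : ¬ IsPivot C S := by
  rintro ⟨b, hb, s, hs, hlt⟩
  have hkey := (S.boxKey_lt_iff_boxColumn_lt hs.1 hb.1).mpr hlt
  rcases boxRank_lt_iff.mp (hinit s hs.1 b hb.1) with h | h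
  -- Such a T differs from S, yet no other member of the chain can separate a box of the space
  -- before S from one of the space after it.
  · obtain ⟨T, hT, hsT, hbT⟩ := exists_mem_of_boxLevel_lt h
    have hne : S ≠ T := fun h => hSD (h ▸ hT)
    rcases hC.total hS (hDC hT) with h' | h'
    · exact hbT (hb.2 T (hDC hT) (h'.lt_of_ne hne))
    · exact hs.2 T (hDC hT) (h'.lt_of_ne hne.symm) hsT
  · exact lt_asymm hkey h.2

/-- Enlarging the chain shrinks both spaces, but the last box of S and the first position outside S
in the rank order survive, and they still witness the pivot. -/
theorem isPivot_of_isPivot (hDC : D ⊆ C)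
    (hC : IsChain (· ≤ ·) (C : Set (CylindricPartition c))) (hslice : ∀ S ∈ C, S.IsSlice)
    (hinit : ∀ S ∈ C, IsInitialFor D S.boxes) {S : CylindricPartition c} (hS : S ∈ D)
    (hpiv : IsPivot D S) : IsPivot C S := by
  obtain ⟨b, hb, s, hs, hlt⟩ := hpiv
  have hD : IsChain (· ≤ ·) (D : Set (CylindricPartition c)) := hC.mono hDC
  obtain ⟨s', hs', hmax⟩ := S.boxes_finite.exists_maximalFor (boxRank D) _ ⟨s, hs.1⟩
  obtain ⟨b', hb', hmin⟩ := (InvImage.wf (boxRank D) wellFounded_lt).has_min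
    {p | p ∉ S.boxes} ⟨b, hb.1⟩
  have hss' : boxRank D s ≤ boxRank D s' := not_lt.mp fun h => (hmax hs.1 h.le).not_gt h
  have hbb' : boxRank D b' ≤ boxRank D b := not_lt.mp (hmin b hb.1)
  have hs'C : s' ∈ spaceBefore C S := by
    refine ⟨hs', fun T hT hTS hs'T => hTS.not_ge ((hslice S (hDC hS)).le_iff.mpr fun p hp => ?_)⟩
    by_contra hpT
    exact (hmax hp (hinit T hT s' hs'T p hpT).le).not_gt (hinit T hT s' hs'T p hpT)
  have hb'C : b' ∈ spaceAfter C S := by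
    refine ⟨hb', fun T hT hST => ?_⟩
    by_contra hb'T
    refine hST.not_ge ((hslice T hT).le_iff.mpr fun p hp => ?_)
    by_contra hpS
    exact hmin p hpS (hinit T hT p hp b' hb'T)
  -- Together with the comparison of ranks this makes the levels equal, so passing from s to s' can
  -- only raise the key; dually for b and b'.
  have hs_level : boxLevel D s' ≤ boxLevel D s := boxLevel_le_of_forall fun T hT hsT => by
    rcases hD.total hS hT with h | h
    · exact CylindricPartition.boxes_subset_of_le h hs'
    · rcases h.eq_or_lt with rfl | h
      · exact hs'
      · exact absurd hsT (hs.2 T hT h)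
  have hb_level : boxLevel D b ≤ boxLevel D b' := boxLevel_le_of_forall fun T hT hb'T => by
    rcases hD.total hT hS with h | h
    · exact absurd (CylindricPartition.boxes_subset_of_le h hb'T) hb'
    · rcases h.eq_or_lt with rfl | h
      · exact absurd hb'T hb'
      · exact hb.2 T hT h
  have hkey := (S.boxKey_lt_iff_boxColumn_lt hs.1 hb.1).mpr hlt
  refine ⟨b', hb'C, s', hs'C, (S.boxKey_lt_iff_boxColumn_lt hs' hb').mp ?_⟩
  have h1 := boxRank_lt_iff.not.mp hss'.not_gt
  have h2 := boxRank_lt_iff.not.mp hbb'.not_gt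
  omega

open Classical in
theorem filter_isPivot_eq (hDC : D ⊆ C) (hD : IsPivotChain D)
    (hslice : ∀ S ∈ C, S.IsSlice) (hinit : ∀ S ∈ C, IsInitialFor D S.boxes) :
    C.filter (IsPivot C) = D := by
  have hC : IsChain (· ≤ ·) (C : Set (CylindricPartition c)) := fun S hS T hT _ =>
    ((hinit S hS).subset_or_subset (hinit T hT)).imp (hslice S hS).le_iff.mpr
      (hslice T hT).le_iff.mpr
  ext S
  rw [Finset.mem_filter]
  refine ⟨fun h => ?_, fun h => ⟨hDC h, isPivot_of_isPivot hDC hC hslice hinit h (hD.2 S h).2.2⟩⟩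
  by_contra hS
  exact not_isPivot_of_isInitialFor hDC hC h.1 hS (hinit S h.1) h.2

end

/-! ### Slice lists and stacking -/

namespace CylindricPartition

variable {r : ℕ} {c : Fin r → ℕ}

theorem part_le_maxPart (Λ : CylindricPartition c) (i : Fin r) (j : ℕ) :
    Λ.part i j ≤ Λ.maxPart :=
  (Λ.antitone_part i (Nat.zero_le j)).trans
    (Finset.le_sup (f := fun i => Λ.part i 0) (Finset.mem_univ i))

theorem isSlice_sliceAt (Λ : CylindricPartition c) (k : ℕ) (hk : 1 ≤ k) :
    (Λ.sliceAt k hk).IsSlice := fun i j => by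
  unfold sliceAt
  dsimp only
  split_ifs <;> omega

theorem sliceAt_anti (Λ : CylindricPartition c) {k m : ℕ} (hk : 1 ≤ k) (hm : 1 ≤ m)
    (h : k ≤ m) : Λ.sliceAt m hm ≤ Λ.sliceAt k hk := fun i j => by
  have : (if m ≤ Λ.part i j then 1 else 0) ≤ (if k ≤ Λ.part i j then 1 else 0 : ℕ) := by
    split_ifs <;> omega
  exact this

theorem isSlice_and_ne_empty_of_mem_sliceList (Λ : CylindricPartition c)
    {S : CylindricPartition c} (hS : S ∈ Λ.sliceList) : S.IsSlice ∧ S ≠ empty c := by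
  obtain ⟨k, hk, rfl⟩ := List.mem_map.mp hS
  refine ⟨Λ.isSlice_sliceAt _ _, fun h => ?_⟩
  obtain ⟨i, -, hi⟩ := Finset.lt_sup_iff.mp (List.mem_range.mp hk)
  have h' : (if k + 1 ≤ Λ.part i 0 then 1 else 0) = 0 :=
    congrFun (congrFun (congrArg part h) i) 0
  rw [if_pos (Nat.succ_le_of_lt hi)] at h'
  omega

theorem mem_sliceChain (Λ : CylindricPartition c) {S : CylindricPartition c} :
    S ∈ Λ.sliceChain ↔ S ∈ Λ.sliceList := by
  classical
  simp [sliceChain]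

theorem isChain_sliceChain (Λ : CylindricPartition c) :
    IsChain (· ≤ ·) (Λ.sliceChain : Set (CylindricPartition c)) := by
  intro S hS T hT _
  obtain ⟨k, -, rfl⟩ := List.mem_map.mp (Λ.mem_sliceChain.mp hS)
  obtain ⟨m, -, rfl⟩ := List.mem_map.mp (Λ.mem_sliceChain.mp hT)
  exact (le_total m k).imp (fun h => Λ.sliceAt_anti _ _ (by omega))
    fun h => Λ.sliceAt_anti _ _ (by omega)

theorem sum_map_part_sliceList (Λ : CylindricPartition c) (i : Fin r) (j : ℕ) :
    (Λ.sliceList.map fun S => S.part i j).sum = Λ.part i j := by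
  have h := Λ.part_le_maxPart i j
  have h1 : (Λ.sliceList.map fun S => S.part i j).sum =
      ∑ k ∈ Finset.range Λ.maxPart, if k + 1 ≤ Λ.part i j then 1 else 0 := by
    rw [sliceList, List.map_map]
    rfl
  have h2 : (Finset.range Λ.maxPart).filter (fun k => k + 1 ≤ Λ.part i j) =
      Finset.range (Λ.part i j) := by
    ext k
    simp only [Finset.mem_filter, Finset.mem_range]
    omega
  rw [h1, ← Finset.card_filter, h2, Finset.card_range]

theorem ext_sliceList {Λ Λ' : CylindricPartition c}
    (h : (Λ.sliceList : Multiset (CylindricPartition c)) = Λ'.sliceList) : Λ = Λ' := by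
  ext i j
  rw [← Λ.sum_map_part_sliceList, ← Λ'.sum_map_part_sliceList]
  exact (Multiset.coe_eq_coe.mp h).map _ |>.sum_eq

theorem finite_support_part (Λ : CylindricPartition c) (i : Fin r) :
    (Function.support (Λ.part i)).Finite := by
  obtain ⟨N, hN⟩ := Λ.eventually_zero i
  refine (Finset.range N).finite_toSet.subset fun j hj => ?_
  by_contra h
  exact hj (hN j (by simpa using h))

theorem size_eq_sum_sliceList (Λ : CylindricPartition c) :
    Λ.size = (Λ.sliceList.map size).sum := by
  have h1 : (Λ.sliceList.map size).sum = ∑ k ∈ Finset.range Λ.maxPart,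
      (Λ.sliceAt (k + 1) (Nat.succ_pos k)).size := by
    rw [sliceList, List.map_map]
    rfl
  rw [h1]
  unfold size
  rw [Finset.sum_comm]
  refine Finset.sum_congr rfl fun i _ => ?_
  rw [← finsum_sum_comm _ _ fun k _ => finite_support_part _ i]
  refine finsum_congr fun j => ?_
  rw [← sum_map_part_sliceList, sliceList, List.map_map]
  rfl

/-- The cylindric partition obtained by stacking the members of a list. -/
def stack (L : List (CylindricPartition c)) : CylindricPartition c where
  part i j := (L.map fun S => S.part i j).sum
  antitone_part i a b hab := List.sum_le_sum fun S _ => S.antitone_part i hab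
  eventually_zero i := by
    induction L with
    | nil => exact ⟨0, fun _ _ => rfl⟩
    | cons S L ih =>
      obtain ⟨N, hN⟩ := ih
      obtain ⟨M, hM⟩ := S.eventually_zero i
      refine ⟨max M N, fun j hj => ?_⟩
      rw [List.map_cons, List.sum_cons, hM j (by omega), hN j (by omega)]
  interlace i j := List.sum_le_sum fun S _ => S.interlace i j

/-- At a fixed position the list reads as ones followed by zeros, so the sum counts the leading
ones. -/
theorem succ_le_sum_part_iff {L : List (CylindricPartition c)} (hL : L.Pairwise (· ≥ ·))
    (hslice : ∀ S ∈ L, S.IsSlice) (i : Fin r) (j k : ℕ) (hk : k < L.length) :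
    k + 1 ≤ (L.map fun S => S.part i j).sum ↔ 0 < L[k].part i j := by
  induction L generalizing k with
  | nil => exact absurd hk (by simp)
  | cons S L ih =>
    rw [List.pairwise_cons] at hL
    rw [List.map_cons, List.sum_cons]
    have hS := hslice S List.mem_cons_self i j
    rcases Nat.eq_zero_or_pos (S.part i j) with h0 | h0
    · have hzero : ∀ T ∈ L, T.part i j = 0 := fun T hT =>
        Nat.le_zero.mp (h0 ▸ hL.1 T hT i j)
      have hsum : (L.map fun S => S.part i j).sum = 0 := by
        rw [List.sum_eq_zero_iff]
        intro x hx
        obtain ⟨T, hT, rfl⟩ := List.mem_map.mp hx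
        exact hzero T hT
      have hk0 : (S :: L)[k].part i j = 0 := by
        rcases List.mem_cons.mp (List.getElem_mem hk) with h | h
        · rw [h, h0]
        · exact hzero _ h
      omega
    · cases k with
      | zero =>
        rw [List.getElem_cons_zero]
        omega
      | succ k =>
        have := ih hL.2 (fun T hT => hslice T (List.mem_cons_of_mem _ hT)) k (by simpa using hk)
        rw [List.getElem_cons_succ, ← this]
        omega

theorem sliceList_stack {L : List (CylindricPartition c)} (hL : L.Pairwise (· ≥ ·))
    (hslice : ∀ S ∈ L, S.IsSlice ∧ S ≠ empty c) : (stack L).sliceList = L := by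
  have hpart : ∀ i j, (stack L).part i j = (L.map fun S => S.part i j).sum := fun _ _ => rfl
  have hlen : (stack L).maxPart = L.length := by
    refine le_antisymm (Finset.sup_le fun i _ => ?_) ?_
    · have := List.sum_le_card_nsmul (L.map fun S => S.part i 0) 1 (by
        intro x hx
        obtain ⟨T, hT, rfl⟩ := List.mem_map.mp hx
        exact (hslice T hT).1 i 0)
      rw [hpart]
      simpa using this
    · rcases Nat.eq_zero_or_pos L.length with h | h
      · omega
      -- The last member has a box, and at that box every member contributes 1.
      · have hk : L.length - 1 < L.length := by omega
        have hmem := hslice _ (List.getElem_mem hk)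
        obtain ⟨p, hp⟩ := hmem.1.boxes_nonempty hmem.2
        have := (succ_le_sum_part_iff hL (fun S hS => (hslice S hS).1) p.1 p.2 _ hk).mpr hp
        have h2 := (stack L).part_le_maxPart p.1 p.2
        rw [hpart] at h2
        omega
  refine List.ext_getElem (by simp [sliceList, hlen]) fun k hk₁ hk₂ => ?_
  ext i j
  have h := succ_le_sum_part_iff hL (fun S hS => (hslice S hS).1) i j k hk₂
  have h' := (hslice _ (List.getElem_mem hk₂)).1 i j
  have h'' : (stack L).sliceList[k].part i j =
      if k + 1 ≤ (L.map fun S => S.part i j).sum then 1 else 0 := by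
    simp only [sliceList, List.getElem_map, List.getElem_range]
    rfl
  rw [h'']
  split_ifs <;> omega

theorem exists_sliceList_eq (M : Multiset (CylindricPartition c))
    (hslice : ∀ S ∈ M, S.IsSlice ∧ S ≠ empty c)
    (hchain : ∀ S ∈ M, ∀ T ∈ M, S ≤ T ∨ T ≤ S) :
    ∃ Λ : CylindricPartition c, (Λ.sliceList : Multiset (CylindricPartition c)) = M := by
  classical
  let R : CylindricPartition c → CylindricPartition c → Prop := fun S T => T.size ≤ S.size
  have : Std.Total R := ⟨fun S T => le_total _ _⟩
  have : IsTrans _ R := ⟨fun S T U h h' => le_trans h' h⟩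
  have hperm := List.perm_insertionSort R M.toList
  have hmem : ∀ S ∈ M.toList.insertionSort R, S ∈ M := fun S hS =>
    Multiset.mem_toList.mp (hperm.mem_iff.mp hS)
  have hpair : (M.toList.insertionSort R).Pairwise (· ≥ ·) := by
    refine (List.pairwise_insertionSort R M.toList).imp_of_mem fun {S T} hS hT h => ?_
    -- Sorting by decreasing weight suffices: comparable slices in the wrong order must coincide.
    rcases hchain S (hmem S hS) T (hmem T hT) with h' | h'
    · exact ((hslice S (hmem S hS)).1.eq_of_le_of_size_le (hslice T (hmem T hT)).1 h' h).ge
    · exact h'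
  refine ⟨stack (M.toList.insertionSort R), ?_⟩
  rw [sliceList_stack hpair fun S hS => hslice S (hmem S hS), Multiset.coe_eq_coe.mpr hperm,
    Multiset.coe_toList]

end CylindricPartition

/-! ### The correspondence with pairs of partitions -/

section

variable {r : ℕ} {c : Fin r → ℕ}

open CylindricPartition

theorem isLabeledDistinctPartition_of_isAdmissible {β : Finset (ℕ × (Fin (r - 1) → ℕ))}
    (h : IsAdmissible c β) : IsLabeledDistinctPartition (∑ k, c k) β := by
  classical
  obtain ⟨C, hC, rfl⟩ := h
  refine ⟨fun x hx => ?_, fun x hx y hy hxy => ?_⟩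
  · obtain ⟨S, hS, rfl⟩ := Finset.mem_image.mp hx
    exact ⟨(hC.2 S hS).1.size_pos (hC.2 S hS).2.1, S.isShape_shape⟩
  · obtain ⟨S, hS, rfl⟩ := Finset.mem_image.mp hx
    obtain ⟨T, hT, rfl⟩ := Finset.mem_image.mp hy
    have hsize : S.size = T.size := hxy
    rcases hC.1.total hS hT with h' | h'
    · rw [(hC.2 S hS).1.eq_of_le_of_size_le (hC.2 T hT).1 h' hsize.ge]
    · rw [(hC.2 T hT).1.eq_of_le_of_size_le (hC.2 S hS).1 h' hsize.le]

open Classical in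
/-- The pivots in the chain of distinct slices of `Λ`. -/
noncomputable def pivotChain (Λ : CylindricPartition c) : Finset (CylindricPartition c) :=
  Λ.sliceChain.filter (IsPivot Λ.sliceChain)

theorem pivotPart_eq (Λ : CylindricPartition c) :
    pivotPart Λ = (pivotChain Λ).image labeledPart := by
  classical
  unfold pivotPart pivotChain
  congr

theorem isSlice_of_mem_sliceChain (Λ : CylindricPartition c) :
    ∀ S ∈ Λ.sliceChain, S.IsSlice ∧ S ≠ empty c := fun _ hS =>
  Λ.isSlice_and_ne_empty_of_mem_sliceList (Λ.mem_sliceChain.mp hS)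

theorem isPivotChain_pivotChain (Λ : CylindricPartition c) : IsPivotChain (pivotChain Λ) :=
  isPivotChain_filter_isPivot Λ.isChain_sliceChain (isSlice_of_mem_sliceChain Λ)

theorem pivotChain_val_le (Λ : CylindricPartition c) :
    (pivotChain Λ).val ≤ (Λ.sliceList : Multiset (CylindricPartition c)) := by
  classical
  rw [Multiset.le_iff_subset (pivotChain Λ).nodup]
  intro S hS
  exact Λ.mem_sliceChain.mp (Finset.mem_of_mem_filter S hS)

theorem map_fst_image_labeledPart {D : Finset (CylindricPartition c)}
    (hD : ∀ S ∈ D, S.IsSlice) :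
    (D.image labeledPart).val.map Prod.fst = D.val.map size := by
  rw [Finset.image_val_of_injOn fun S hS T hT h =>
    (hD S hS).eq_of_labeledPart_eq (hD T hT) h, Multiset.map_map]
  rfl

/-- Lifts the subtraction of weights to one of slices: pivots form a submultiset of the slice list,
and distinct pivots have distinct labels, so nothing is truncated. -/
theorem exists_sliceList_eq_add (Λ : CylindricPartition c) :
    ∃ M : Multiset (CylindricPartition c),
      (Λ.sliceList : Multiset (CylindricPartition c)) = (pivotChain Λ).val + M ∧
      remainingPart Λ = M.map size ∧
      (∀ S ∈ M, S.IsSlice ∧ S ≠ empty c ∧ IsInitialFor (pivotChain Λ) S.boxes) := by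
  obtain ⟨M, hM⟩ := Multiset.le_iff_exists_add.mp (pivotChain_val_le Λ)
  refine ⟨M, hM, ?_, fun S hS => ?_⟩
  · rw [remainingPart, pivotPart_eq,
      map_fst_image_labeledPart fun S hS => ((isPivotChain_pivotChain Λ).2 S hS).1,
      ← Multiset.map_coe, hM, Multiset.map_add, add_tsub_cancel_left]
  · have hS' : S ∈ Λ.sliceChain := by
      rw [Λ.mem_sliceChain, ← Multiset.mem_coe, hM]
      exact Multiset.mem_add.mpr (Or.inr hS)
    have h := isSlice_of_mem_sliceChain Λ
    exact ⟨(h S hS').1, (h S hS').2,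
      isInitialFor_filter_isPivot Λ.isChain_sliceChain (fun T hT => (h T hT).1) hS'⟩

theorem remainingPart_pivotPart_injective (hr : 0 < r) (hc : 0 < ∑ k, c k)
    {Λ Λ' : CylindricPartition c} (hrem : remainingPart Λ = remainingPart Λ')
    (hpiv : pivotPart Λ = pivotPart Λ') : Λ = Λ' := by
  classical
  have hD : pivotChain Λ = pivotChain Λ' := by
    rw [pivotPart_eq, pivotPart_eq] at hpiv
    have hsub : ∀ Λ Λ' : CylindricPartition c, (pivotChain Λ).image labeledPart =
        (pivotChain Λ').image labeledPart → pivotChain Λ ⊆ pivotChain Λ' := by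
      intro Λ Λ' h S hS
      obtain ⟨T, hT, hTS⟩ := Finset.mem_image.mp (h ▸ Finset.mem_image_of_mem labeledPart hS)
      rwa [← ((isPivotChain_pivotChain Λ').2 T hT).1.eq_of_labeledPart_eq
        ((isPivotChain_pivotChain Λ).2 S hS).1 hTS]
    exact (hsub _ _ hpiv).antisymm (hsub _ _ hpiv.symm)
  obtain ⟨M, hM, hMrem, hMslice⟩ := exists_sliceList_eq_add Λ
  obtain ⟨M', hM', hMrem', hMslice'⟩ := exists_sliceList_eq_add Λ'
  -- The remaining slices are recovered from their weights as initial segments for D.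
  have hmap : ∀ (M : Multiset (CylindricPartition c)) (D : Finset (CylindricPartition c)),
      (∀ S ∈ M, S.IsSlice ∧ S ≠ empty c ∧ IsInitialFor D S.boxes) →
      (M.map size).map (refinedSlice hr hc D) = M := by
    intro M D h
    rw [Multiset.map_map]
    exact (Multiset.map_congr rfl fun S hS =>
      refinedSlice_size hr hc (h S hS).1 (h S hS).2.2).trans (Multiset.map_id M)
  apply ext_sliceList
  rw [hM, hM', ← hmap M _ hMslice, ← hmap M' _ hMslice', ← hMrem, ← hMrem', hrem, hD]

theorem exists_remainingPart_pivotPart_eq (hr : 0 < r) (hc : 0 < ∑ k, c k) {μ : Multiset ℕ}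
    (hμ : IsUnrestrictedPartition μ) {D : Finset (CylindricPartition c)} (hD : IsPivotChain D) :
    ∃ Λ : CylindricPartition c, remainingPart Λ = μ ∧ pivotPart Λ = D.image labeledPart := by
  classical
  have hmem : ∀ S ∈ D.val + μ.map (refinedSlice hr hc D),
      (S.IsSlice ∧ S ≠ empty c) ∧ IsInitialFor D S.boxes := by
    intro S hS
    rcases Multiset.mem_add.mp hS with hS | hS
    · exact ⟨⟨(hD.2 S hS).1, (hD.2 S hS).2.1⟩, hD.1.isInitialFor hS⟩
    · obtain ⟨n, hn, rfl⟩ := Multiset.mem_map.mp hS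
      refine ⟨⟨isSlice_refinedSlice hr hc D n, fun h => ?_⟩, isInitialFor_refinedSlice hr hc D n⟩
      have h1 := size_refinedSlice hr hc D n
      rw [h] at h1
      have h2 : (empty c).size = 0 := by simp [size, empty]
      have := hμ n hn
      -- Positivity of the parts of μ excludes the empty slice.
      omega
  obtain ⟨Λ, hΛ⟩ := exists_sliceList_eq _ (fun S hS => (hmem S hS).1) fun S hS T hT =>
    ((hmem S hS).2.subset_or_subset (hmem T hT).2).imp (hmem S hS).1.1.le_iff.mpr
      (hmem T hT).1.1.le_iff.mpr
  have hchain : ∀ S, S ∈ Λ.sliceChain ↔ S ∈ D.val + μ.map (refinedSlice hr hc D) := fun S => by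
    rw [Λ.mem_sliceChain, ← Multiset.mem_coe, hΛ]
  have hpiv : pivotChain Λ = D := filter_isPivot_eq
    (fun S hS => (hchain S).mpr (Multiset.mem_add.mpr (Or.inl hS))) hD
    (fun S hS => (hmem S ((hchain S).mp hS)).1.1) fun S hS => (hmem S ((hchain S).mp hS)).2
  refine ⟨Λ, ?_, by rw [pivotPart_eq, hpiv]⟩
  obtain ⟨M, hM, hMrem, -⟩ := exists_sliceList_eq_add Λ
  rw [hΛ, hpiv, add_right_inj] at hM
  rw [hMrem, ← hM, Multiset.map_map]
  exact (Multiset.map_congr rfl fun n _ => size_refinedSlice hr hc D n).trans (Multiset.map_id μ)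

theorem size_eq_remainingPart_add_pivotPart (Λ : CylindricPartition c) :
    Λ.size = (remainingPart Λ).sum + ∑ x ∈ pivotPart Λ, x.1 := by
  obtain ⟨M, hM, hMrem, -⟩ := exists_sliceList_eq_add Λ
  rw [size_eq_sum_sliceList, ← Multiset.sum_coe, ← Multiset.map_coe, hM, Multiset.map_add,
    Multiset.sum_add, hMrem, add_comm, Finset.sum_eq_multiset_sum, pivotPart_eq,
    map_fst_image_labeledPart fun S hS => ((isPivotChain_pivotChain Λ).2 S hS).1]

end

/-! ### Runs of consecutive weights -/

section

variable {r : ℕ} {c : Fin r → ℕ}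

open CylindricPartition

theorem run_le_of_isPivotChain {C : Finset (CylindricPartition c)} (hC : IsPivotChain C)
    {n m : ℕ} (h : ∀ k < m, ∃ S ∈ C, S.size = n + k) :
    m ≤ min (r - 1) ((∑ k, c k) - 1) := by
  rcases Nat.eq_zero_or_pos m with rfl | hm
  · exact Nat.zero_le _
  have h' : ∀ k : Fin m, ∃ S ∈ C, S.size = n + k := fun k => h k k.isLt
  choose S hSC hsize using h'
  have hpiv := fun k => (hC.2 (S k) (hSC k)).2.2
  choose b hb s hs hlt using hpiv
  have hslice : ∀ k, (S k).IsSlice := fun k => (hC.2 _ (hSC k)).1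
  have hmono : StrictMono S := by
    intro k k' hk
    have hne : (S k).size < (S k').size := by
      rw [hsize, hsize]
      exact Nat.add_lt_add_left hk n
    rcases hC.1.total (hSC k) (hSC k') with h1 | h1
    · exact h1.lt_of_ne fun h2 => hne.ne (congrArg size h2)
    · have := Set.ncard_le_ncard (boxes_subset_of_le h1) (S k).boxes_finite
      rw [← (hslice k).size_eq_ncard, ← (hslice k').size_eq_ncard] at this
      omega
  have hbmem : ∀ k k', k < k' → b k ∈ (S k').boxes := fun k k' hk =>
    (hb k).2 _ (hSC k') (hmono hk)
  -- Both boxes are in the larger slice and outside the smaller one, and the weights differ by only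
  -- 1.
  have hstep : ∀ k k' : Fin m, (k : ℕ) + 1 = k' → b k = s k' := by
    intro k k' hk
    have hkk : k < k' := Fin.lt_def.mpr (by omega)
    by_contra hne
    have hsub : insert (b k) (insert (s k') (S k).boxes) ⊆ (S k').boxes :=
      Set.insert_subset (hbmem k k' hkk) (Set.insert_subset (hs k').1
        (boxes_subset_of_le (hmono hkk).le))
    have hcard := Set.ncard_le_ncard hsub (S k').boxes_finite
    have hs' : s k' ∉ (S k).boxes := (hs k').2 _ (hSC k) (hmono hkk)
    rw [Set.ncard_insert_of_notMem (fun h => h.elim hne (hb k).1)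
      ((S k).boxes_finite.insert _), Set.ncard_insert_of_notMem hs' (S k).boxes_finite,
      ← (hslice k).size_eq_ncard, ← (hslice k').size_eq_ncard, hsize, hsize] at hcard
    omega
  let z : Fin m := ⟨0, hm⟩
  have hcol : ∀ k (hk : k < m), boxColumn c (b ⟨k, hk⟩) + k < boxColumn c (s z) := by
    intro k
    induction k with
    | zero => exact fun _ => hlt z
    | succ k ih =>
      intro hk
      have h1 := ih (by omega)
      have h2 := hlt ⟨k + 1, hk⟩
      rw [← hstep ⟨k, by omega⟩ ⟨k + 1, hk⟩ rfl] at h2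
      omega
  have hanti : ∀ j k (hk : j + k + 1 < m), boxColumn c (b ⟨j + k + 1, hk⟩) <
      boxColumn c (b ⟨j, by omega⟩) := by
    intro j k
    induction k with
    | zero =>
      intro hk
      rw [hstep ⟨j, by omega⟩ ⟨j + 0 + 1, hk⟩ rfl]
      exact hlt _
    | succ k ih =>
      intro hk
      refine lt_trans ?_ (ih (by omega))
      rw [hstep ⟨j + k + 1, by omega⟩ ⟨j + (k + 1) + 1, hk⟩ rfl]
      exact hlt _
  have hbz : ∀ k, b k ∉ (S z).boxes := fun k h =>
    (hb k).1 (boxes_subset_of_le (hmono.monotone (Fin.le_def.mpr (Nat.zero_le _))) h)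
  rw [le_min_iff]
  constructor
  -- In the first row, a position to the left of the box `s z` would itself belong to `S z`.
  · have hrow_ne : ∀ k, ((b k).1 : ℕ) ≠ 0 := by
      intro k h0
      refine hbz k ((S z).mem_boxes_of_le (hs z).1 (Fin.le_def.mpr (by omega)) ?_)
      exact (Nat.le_add_right _ _).trans (hcol k k.isLt).le
    -- In a common row, `b k` would be left of `b j`, which is a box of `S k`, contradicting that `b
    -- k` is outside `S k`.
    have hrow_lt : ∀ j k : Fin m, j < k → (b j).1 ≠ (b k).1 := by
      intro j k hjk heq
      have h1 := hanti j (k - j - 1) (by omega)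
      have h2 : (⟨j + (k - j - 1) + 1, by omega⟩ : Fin m) = k := Fin.ext (by simp; omega)
      rw [h2] at h1
      exact (hb k).1 ((S k).mem_boxes_of_le (hbmem j k hjk) heq.ge h1.le)
    have hcard := Finset.card_le_card_of_injOn (s := (Finset.univ : Finset (Fin m)))
      (t := Finset.Ico 1 r) (fun k => ((b k).1 : ℕ))
      (fun k _ => by
        have := hrow_ne k
        have := (b k).1.isLt
        simp only [Finset.coe_Ico, Set.mem_Ico]
        omega)
      (fun j _ k _ heq => by
        rcases lt_trichotomy j k with h | h | h
        · exact absurd (Fin.ext heq) (hrow_lt j k h)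
        · exact h
        · exact absurd (Fin.ext heq.symm) (hrow_lt k j h))
    simpa using hcard
  -- The last b is at least m columns left of `s z`, while a position outside `S z` is fewer than ℓ
  -- columns left of any box of `S z`.
  · have h1 := hcol (m - 1) (by omega)
    have h2 := (S z).boxColumn_lt_add (hs z).1 (hbz ⟨m - 1, by omega⟩)
    omega

end

theorem mainTheorem1 (r l : ℕ) (hr : 0 < r) (hl : 0 < l) (c : Fin r → ℕ) (hc : ∑ i, c i = l) :
    Set.BijOn (fun Λ : CylindricPartition c => (remainingPart Λ, pivotPart Λ)) Set.univ
      {p | IsUnrestrictedPartition p.1 ∧ IsLabeledDistinctPartition l p.2 ∧ IsAdmissible c p.2} ∧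
    (∀ Λ : CylindricPartition c,
      Λ.size = (remainingPart Λ).sum + ∑ x ∈ pivotPart Λ, x.1) ∧
    (∀ β : Finset (ℕ × (Fin (r - 1) → ℕ)), IsAdmissible c β →
      IsLabeledDistinctPartition l β ∧
        ∀ n m : ℕ, HasRun β n m → m ≤ min (r - 1) (l - 1)) := by
  classical
  subst hc
  refine ⟨⟨fun Λ _ => ⟨fun n hn => ?_, ?_⟩, fun Λ _ Λ' _ h => ?_, ?_⟩,
    size_eq_remainingPart_add_pivotPart, fun β hβ =>
      ⟨isLabeledDistinctPartition_of_isAdmissible hβ, fun n m hrun => ?_⟩⟩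
  · obtain ⟨M, -, hMrem, hM⟩ := exists_sliceList_eq_add Λ
    have hn : n ∈ remainingPart Λ := hn
    rw [hMrem] at hn
    obtain ⟨S, hS, rfl⟩ := Multiset.mem_map.mp hn
    exact (hM S hS).1.size_pos (hM S hS).2.1
  · have hadm : IsAdmissible c (pivotPart Λ) :=
      ⟨pivotChain Λ, isPivotChain_pivotChain Λ, by rw [pivotPart_eq]⟩
    exact ⟨isLabeledDistinctPartition_of_isAdmissible hadm, hadm⟩
  · exact remainingPart_pivotPart_injective hr hl (congrArg Prod.fst h) (congrArg Prod.snd h)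
  · rintro ⟨μ, β⟩ ⟨hμ, -, D, hD, rfl⟩
    obtain ⟨Λ, h1, h2⟩ := exists_remainingPart_pivotPart_eq hr hl hμ hD
    refine ⟨Λ, trivial, Prod.ext h1 (h2.trans ?_)⟩
    congr
  · obtain ⟨C, hC, rfl⟩ := hβ
    refine run_le_of_isPivotChain (n := n) hC fun k hk => ?_
    obtain ⟨x, hx, hxn⟩ := hrun k hk
    obtain ⟨S, hS, rfl⟩ := Finset.mem_image.mp hx
    exact ⟨S, hS, hxn⟩
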